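/- Let $\Gamma$ be a group, let $\Delta$ be a non-trivial group, and let $G$ be a simple graph (no loops, no multiple edges) with vertex set $\Gamma$ such that left multiplication by each element of $\Gamma$ is a graph automorphism of $G$. Write $e$ for the identity of $\Gamma$ and $N(e)\subseteq\Gamma$ for the set of neighbours of $e$ in $G$. Let $$G(\Delta)=\Bigl(\mathop{\ast}_{v\in\Gamma}\Delta_{(v)}\Bigr)\Big/\bigl\langle\!\bigl\langle\,[g_{(v)},h_{(w)}] \;:\; g,h\in\Delta,\ v,w \text{ adjacent in } G\,\bigr\rangle\!\bigr\rangle$$ be the graph product, where $\Delta_{(v)}=\{g_{(v)} : g\in\Delta\}$ is a copy of $\Delta$, and let $G(\Delta)\rtimes\Gamma$ be the (regular) graph wreath product, the semidirect product for the action $\gamma\cdot g_{(v)}=g_{(\gamma v)}$. Then $G(\Delta)\rtimes\Gamma$ is residually finite if and only if $\Gamma$ and $\Delta$ are residually finite and the following two conditions hold: 1. $\Delta$ is abelian, or there is a finite index subgroup $K\le\Gamma$ with $K\cap N(e)=\emptyset$; 2. for every $w\in\Gamma$ with $w\neq e$ that is not adjacent to $e$, there is a finite index subgroup $K\le\Gamma$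 with $Kw\cap(N(e)\cup\{e\})=\emptyset$. -/

import Mathlib

open scoped commutatorElement

/-- The defining relators of the graph product: in the free product of copies `Δ_(v)` of `Δ`
indexed by the vertices `v` of `G`, all commutators `[g_(v), h_(w)]` with `v`, `w` adjacent. -/
def graphProductRels {V : Type*} (G : SimpleGraph V) (Δ : Type*) [Group Δ] :
    Set (Monoid.CoprodI (fun _ : V => Δ)) :=
  {x | ∃ (v w : V) (g h : Δ), G.Adj v w ∧
    x = ⁅(Monoid.CoprodI.of (i := v) g : Monoid.CoprodI (fun _ : V => Δ)),
      Monoid.CoprodI.of (i := w) h⁆}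

/-- The graph product `G(Δ)`: the free product of copies of `Δ` indexed by the vertices of `G`,
modulo the normal closure of the commutators of copies at adjacent vertices. -/
abbrev GraphProduct {V : Type*} (G : SimpleGraph V) (Δ : Type*) [Group Δ] : Type _ :=
  Monoid.CoprodI (fun _ : V => Δ) ⧸ Subgroup.normalClosure (graphProductRels G Δ)

namespace GraphProduct

/-- The copy `Δ_(v) → G(Δ)`, `g ↦ g_(v)`. -/
def of {V : Type*} (G : SimpleGraph V) {Δ : Type*} [Group Δ] (v : V) : Δ →* GraphProduct G Δ :=
  (QuotientGroup.mk' (Subgroup.normalClosure (graphProductRels G Δ))).comp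
    (Monoid.CoprodI.of (M := fun _ : V => Δ) (i := v))

theorem commute_of {V : Type*} {G : SimpleGraph V} {Δ : Type*} [Group Δ] {v w : V}
    (hvw : G.Adj v w) (g h : Δ) : Commute (of G v g) (of G w h) := by
  rw [← commutatorElement_eq_one_iff_commute]
  have key := (QuotientGroup.eq_one_iff _).2
    (Subgroup.subset_normalClosure
      (show _ ∈ graphProductRels G Δ from ⟨v, w, g, h, hvw, rfl⟩))
  exact key

/-- The universal property of the graph product. -/
def lift {V : Type*} {G : SimpleGraph V} {Δ : Type*} [Group Δ] {M : Type*} [Group M]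
    (f : V → Δ →* M)
    (hf : ∀ v w : V, G.Adj v w → ∀ g h : Δ, Commute (f v g) (f w h)) :
    GraphProduct G Δ →* M :=
  QuotientGroup.lift _ (Monoid.CoprodI.lift f) (by
    intro x hx
    refine (Subgroup.normalClosure_le_normal (N := (Monoid.CoprodI.lift f).ker) ?_) hx
    rintro _ ⟨v, w, g, h, hvw, rfl⟩
    rw [SetLike.mem_coe, MonoidHom.mem_ker, map_commutatorElement, Monoid.CoprodI.lift_of,
      Monoid.CoprodI.lift_of, commutatorElement_eq_one_iff_commute]
    exact hf v w hvw g h)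

@[simp]
theorem lift_of {V : Type*} {G : SimpleGraph V} {Δ : Type*} [Group Δ] {M : Type*} [Group M]
    (f : V → Δ →* M) (hf : ∀ v w : V, G.Adj v w → ∀ g h : Δ, Commute (f v g) (f w h))
    (v : V) (g : Δ) : lift f hf (of G v g) = f v g :=
  Monoid.CoprodI.lift_of f g

theorem hom_ext {V : Type*} {G : SimpleGraph V} {Δ : Type*} [Group Δ] {M : Type*} [Group M]
    {φ ψ : GraphProduct G Δ →* M} (h : ∀ (v : V) (g : Δ), φ (of G v g) = ψ (of G v g)) :
    φ = ψ := by
  refine QuotientGroup.monoidHom_ext _ (Monoid.CoprodI.ext_hom _ _ fun v => ?_)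
  ext g
  exact h v g

/-- The endomorphism of `G(Δ)` induced by a graph automorphism: `g_(v) ↦ g_(σ v)`. -/
def map {V : Type*} {G : SimpleGraph V} (Δ : Type*) [Group Δ] (σ : G ≃g G) :
    GraphProduct G Δ →* GraphProduct G Δ :=
  lift (fun v => of G (σ v)) fun _ _ hvw g h => commute_of (σ.map_adj_iff.2 hvw) g h

@[simp]
theorem map_of {V : Type*} {G : SimpleGraph V} {Δ : Type*} [Group Δ] (σ : G ≃g G)
    (v : V) (g : Δ) : map Δ σ (of G v g) = of G (σ v) g :=
  lift_of _ _ v g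

theorem map_one {V : Type*} (G : SimpleGraph V) (Δ : Type*) [Group Δ] :
    map Δ (1 : G ≃g G) = MonoidHom.id _ :=
  hom_ext fun v g => map_of 1 v g

theorem map_mul {V : Type*} {G : SimpleGraph V} (Δ : Type*) [Group Δ] (σ τ : G ≃g G) :
    map Δ (σ * τ) = (map Δ σ).comp (map Δ τ) :=
  hom_ext fun v g => by
    rw [MonoidHom.comp_apply, map_of, map_of, map_of]
    rfl

/-- The action of graph automorphisms on `G(Δ)` by group automorphisms. -/
def autHom {V : Type*} (G : SimpleGraph V) (Δ : Type*) [Group Δ] :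
    (G ≃g G) →* MulAut (GraphProduct G Δ) where
  toFun σ := MonoidHom.toMulEquiv (map Δ σ) (map Δ σ⁻¹)
    (by rw [← map_mul, inv_mul_cancel, map_one]) (by rw [← map_mul, mul_inv_cancel, map_one])
  map_one' := MulEquiv.ext fun x => DFunLike.congr_fun (map_one G Δ) x
  map_mul' σ τ := MulEquiv.ext fun x => DFunLike.congr_fun (map_mul Δ σ τ) x

end GraphProduct

/-- The graph wreath product `G(Δ) ⋊ Γ` of `Δ` and `Γ` over a graph `G` on which `Γ` acts (through
`ρ`) by graph automorphisms; `γ` acts on `G(Δ)` by `g_(v) ↦ g_(γ v)`. -/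
abbrev GraphWreathProduct {V : Type*} {G : SimpleGraph V} {Γ : Type*} [Group Γ]
    (ρ : Γ →* (G ≃g G)) (Δ : Type*) [Group Δ] : Type _ :=
  GraphProduct G Δ ⋊[(GraphProduct.autHom G Δ).comp ρ] Γ

/-- For a graph with vertex set `Γ` that is preserved by left multiplication, the action of `Γ` on
it by left multiplication. -/
def leftMulGraphAction {Γ : Type*} [Group Γ] (G : SimpleGraph Γ)
    (hG : ∀ γ v w : Γ, G.Adj v w → G.Adj (γ * v) (γ * w)) : Γ →* (G ≃g G) where
  toFun γ :=
    { toEquiv := Equiv.mulLeft γ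
      map_rel_iff' := fun {v w} =>
        ⟨fun h => by simpa using hG γ⁻¹ _ _ h, fun h => hG γ v w h⟩ }
  map_one' := RelIso.ext fun v => one_mul v
  map_mul' γ δ := RelIso.ext fun v => mul_assoc γ δ v

/-! Necessity: `Γ` and `Δ` embed in the wreath product. If `a_(v)` and `b_(w)` do not commute, some
finite quotient of the wreath product keeps their commutator alive. For `k` in the trace of its
kernel on `Γ`, `a_(kv)` and `a_(v)` have the same image there, so `a_(kv)` and `b_(w)` do not
commute either, and `kv`, `w` are not adjacent. Both conditions are instances of this
(`exists_finiteIndex_not_commute`).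

Sufficiency: an element with non-trivial `Γ`-part is separated in `Γ`. Otherwise take a reduced word
for it and pass to the cosets of a normal `K ≤ Γ` and to `Δ ⧸ N`, both of finite index. Condition 2
and residual finiteness allow a choice that keeps the word reduced; condition 1 makes collapsed
edges harmless. A non-empty reduced word over a finite group acts non-trivially on a finite set
(`exists_path`). The resulting homomorphism is `K`-invariant, hence extends to a finite-index
subgroup of the wreath product. -/

namespace GraphProduct

/-! ### Reduced words -/

section Words

variable {V : Type*} (G : SimpleGraph V) {Δ : Type*}

/-- A word has a syllable at `u` that can be shuffled to its front. -/
def IsHead (u : V) : List (V × Δ) → Prop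
  | [] => False
  | p :: l => u = p.1 ∨ (G.Adj p.1 u ∧ IsHead u l)

/-- A word that cannot be shortened by shuffling and merging syllables. -/
def Reduced [One Δ] : List (V × Δ) → Prop
  | [] => True
  | p :: l => p.2 ≠ 1 ∧ ¬ IsHead G p.1 l ∧ Reduced l

variable [Group Δ]

/-- The element of the graph product spelled by a word. -/
def wordProd (l : List (V × Δ)) : GraphProduct G Δ :=
  (l.map fun p => of G p.1 p.2).prod

@[simp]
theorem wordProd_nil : wordProd G ([] : List (V × Δ)) = 1 := rfl

@[simp]
theorem wordProd_cons (p : V × Δ) (l : List (V × Δ)) :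
    wordProd G (p :: l) = of G p.1 p.2 * wordProd G l := by
  simp [wordProd]

theorem wordProd_append (l m : List (V × Δ)) :
    wordProd G (l ++ m) = wordProd G l * wordProd G m := by
  simp [wordProd]

theorem exists_wordProd_eq (x : GraphProduct G Δ) : ∃ l, wordProd G l = x := by
  obtain ⟨y, rfl⟩ := QuotientGroup.mk_surjective x
  induction y using Monoid.CoprodI.induction_on with
  | one => exact ⟨[], rfl⟩
  | of v g => exact ⟨[(v, g)], by simp [wordProd, of]⟩
  | mul x y hx hy =>
    obtain ⟨l, hl⟩ := hx
    obtain ⟨m, hm⟩ := hy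
    exact ⟨l ++ m, by rw [wordProd_append, hl, hm, QuotientGroup.mk_mul]⟩

variable {G} in
theorem IsHead.exists_wordProd_eq {u : V} : ∀ {l : List (V × Δ)}, IsHead G u l →
    ∃ (g : Δ) (m : List (V × Δ)), m.length < l.length ∧ wordProd G l = of G u g * wordProd G m
  | [], h => h.elim
  | p :: l, h => by
    rcases h with rfl | ⟨hp, h⟩
    · exact ⟨p.2, l, by simp, by simp⟩
    · obtain ⟨g, m, hm, e⟩ := h.exists_wordProd_eq
      refine ⟨g, p :: m, by simpa using hm, ?_⟩
      rw [wordProd_cons, wordProd_cons, e, ← mul_assoc, ← mul_assoc, (commute_of hp p.2 g).eq]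

/-- A trivial syllable could be dropped, and a head equal to the first vertex could be merged into
it; either would shorten the word. -/
theorem reduced_of_minimal : ∀ {l : List (V × Δ)},
    (∀ m, wordProd G m = wordProd G l → l.length ≤ m.length) → Reduced G l
  | [], _ => trivial
  | p :: l, h => by
    refine ⟨fun hp => ?_, fun hp => ?_, reduced_of_minimal fun m hm => ?_⟩
    · have := h l (by simp [hp])
      simp at this
    · obtain ⟨g, m, hm, e⟩ := hp.exists_wordProd_eq
      have := h ((p.1, p.2 * g) :: m) (by simp [e, mul_assoc])
      simp only [List.length_cons] at this
      omega
    · simpa using h (p :: m) (by simp [hm])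

theorem exists_reduced_wordProd_eq (x : GraphProduct G Δ) :
    ∃ l, Reduced G l ∧ wordProd G l = x := by
  classical
  have hex : ∃ n, ∃ l, wordProd G l = x ∧ l.length = n :=
    let ⟨l, hl⟩ := exists_wordProd_eq G x
    ⟨_, l, hl, rfl⟩
  obtain ⟨l, hl, hn⟩ := Nat.find_spec hex
  refine ⟨l, reduced_of_minimal G fun m hm => ?_, hl⟩
  rw [hn]
  exact Nat.find_min' hex ⟨m, hm.trans hl, rfl⟩

end Words

/-! ### Permutation representations detecting reduced words -/

section Action

variable {V : Type*} (G : SimpleGraph V) {Δ : Type*} [Group Δ] {X : Type*}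

open Classical in
/-- Given permutations `f` of `X`, glue a copy of `Δ` to each fixed point of the copy of `Δ` at `v`,
with that copy acting by translation; the vertices not adjacent to `v` act on `X` only. -/
noncomputable def extendFun (f : V → Δ →* Equiv.Perm X) (v u : V) (h : Δ) (p : X × Δ) : X × Δ :=
  if u = v then if ∀ k, f v k p.1 = p.1 then (p.1, h * p.2) else (f v h p.1, p.2)
  -- Level `1` is the original `X`. Neighbours of `v` must act on every level in order to commute
  -- with the translations.
  else if G.Adj v u ∨ p.2 = 1 then (f u h p.1, p.2) else p

/-- Being a fixed point is constant on orbits, so the case split in `extendFun` is stable under the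
action. -/
theorem forall_apply_apply_eq_iff (φ : Δ →* Equiv.Perm X) (h : Δ) (x : X) :
    (∀ k, φ k (φ h x) = φ h x) ↔ ∀ k, φ k x = x := by
  refine ⟨fun H k => ?_, fun H k => by rw [H h, H k]⟩
  have e : ∀ k, φ (k * h) x = φ h x := fun k => by
    rw [_root_.map_mul, Equiv.Perm.mul_apply, H]
  have e1 : x = φ h x := by simpa using e h⁻¹
  have e2 := e (k * h⁻¹)
  rw [inv_mul_cancel_right] at e2
  exact e2.trans e1.symm

/-- The permutation action underlying `extendFun`. -/
noncomputable def extend (f : V → Δ →* Equiv.Perm X) (v u : V) : Δ →* Equiv.Perm (X × Δ) :=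
  letI : MulAction Δ (X × Δ) :=
    { smul := extendFun G f v u
      one_smul := fun p => by
        change extendFun G f v u 1 p = p
        simp [extendFun]
      mul_smul := fun g h p => by
        change extendFun G f v u (g * h) p = extendFun G f v u g (extendFun G f v u h p)
        unfold extendFun
        by_cases huv : u = v
        · subst huv
          by_cases hp : ∀ k, f u k p.1 = p.1
          · simp [hp, mul_assoc]
          · have hp' : ¬ ∀ k, f u k (f u h p.1) = f u h p.1 := by
              rwa [forall_apply_apply_eq_iff]
            rw [if_pos rfl, if_neg hp, if_pos rfl, if_pos rfl, if_neg hp, if_neg hp',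
              _root_.map_mul, Equiv.Perm.mul_apply]
        · by_cases hp : G.Adj v u ∨ p.2 = 1
          · simp [huv, hp]
          · simp [huv, hp] }
  MulAction.toPermHom Δ (X × Δ)

theorem extend_apply (f : V → Δ →* Equiv.Perm X) (v u : V) (h : Δ) (p : X × Δ) :
    extend G f v u h p = extendFun G f v u h p := rfl

theorem extendFun_comm_aux {f : V → Δ →* Equiv.Perm X}
    (hf : ∀ v w, G.Adj v w → ∀ g h, Commute (f v g) (f w h)) {v w : V} (hw : G.Adj v w)
    (g h : Δ) (p : X × Δ) :
    extendFun G f v v g (extendFun G f v w h p) = extendFun G f v w h (extendFun G f v v g p) := by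
  have hc : ∀ k x, f v k (f w h x) = f w h (f v k x) := fun k x =>
    Equiv.Perm.ext_iff.1 (hf v w hw k h) x
  have hne : w ≠ v := hw.ne'
  by_cases hp : ∀ k, f v k p.1 = p.1
  · simp [extendFun, hne, hw, hc, hp]
  · simp [extendFun, hne, hw, hc, hp]

theorem commute_extend {f : V → Δ →* Equiv.Perm X}
    (hf : ∀ v w, G.Adj v w → ∀ g h, Commute (f v g) (f w h)) (v u w : V) (huw : G.Adj u w)
    (g h : Δ) : Commute (extend G f v u g) (extend G f v w h) := by
  refine Equiv.ext fun p => ?_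
  simp only [Equiv.Perm.mul_apply, extend_apply]
  have hc : ∀ x, f u g (f w h x) = f w h (f u g x) := Equiv.Perm.ext_iff.1 (hf u w huw g h)
  by_cases hu : u = v
  · subst hu
    exact extendFun_comm_aux G hf huw g h p
  by_cases hw : w = v
  · subst hw
    exact (extendFun_comm_aux G hf huw.symm h g p).symm
  by_cases h1 : p.2 = 1
  · simp [extendFun, hu, hw, h1, hc]
  · by_cases hvu : G.Adj v u <;> by_cases hvw : G.Adj v w <;>
      simp [extendFun, hu, hw, h1, hvu, hvw, hc]

/-- Reading the word `l` from its end moves `b` to `x`, and every syllable moves the point. -/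
inductive Path (f : V → Δ →* Equiv.Perm X) (b : X) : List (V × Δ) → X → Prop
  | nil : Path f b [] b
  | cons {l : List (V × Δ)} {x : X} (v : V) (g : Δ) : Path f b l x → f v g x ≠ x →
    Path f b ((v, g) :: l) (f v g x)

theorem Path.prod_apply {f : V → Δ →* Equiv.Perm X} {b x : X} {l : List (V × Δ)}
    (h : Path f b l x) : (l.map fun p => f p.1 p.2).prod b = x := by
  induction h with
  | nil => simp
  | cons v g _ _ ih => simp [ih]

/-- Every syllable moves its point, so the path never uses a translation and stays on level `1`. -/
theorem Path.extend {f : V → Δ →* Equiv.Perm X} {b x : X} {l : List (V × Δ)}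
    (h : Path f b l x) (v : V) : Path (extend G f v) (b, 1) l (x, 1) := by
  induction h with
  | nil => exact .nil
  | @cons l x u g _ hx ih =>
    have e : GraphProduct.extend G f v u g (x, 1) = (f u g x, 1) := by
      rw [extend_apply]
      by_cases hu : u = v
      · subst hu
        have : ¬ ∀ k, f u k x = x := fun H => hx (H g)
        simp [extendFun, this]
      · simp [extendFun, hu]
    rw [← e]
    refine .cons u g ih ?_
    rw [e]
    simpa using hx

/-- The induction carries the invariant that only heads of the word can move the endpoint `x`. A new
first vertex `v` is not a head, so its copy fixes `x`; gluing `Δ` there lets `a` move `(x, 1)` to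
`(x, a)`. Off level `1`, vertices other than `v` and its neighbours act trivially, which restores
the invariant. -/
theorem exists_path.{u} (G : SimpleGraph V) {Δ : Type u} [Group Δ] : ∀ {l : List (V × Δ)}, Reduced G l →
    ∃ (X : Type u) (_ : Finite Δ → Finite X) (f : V → Δ →* Equiv.Perm X) (b x : X),
      (∀ v w, G.Adj v w → ∀ g h, Commute (f v g) (f w h)) ∧ Path f b l x ∧
      (∀ u, ¬ IsHead G u l → ∀ h, f u h x = x) ∧ (l ≠ [] → x ≠ b)
  | [], _ => ⟨PUnit, fun _ => inferInstance, fun _ => 1, .unit, .unit, by simp, .nil, by simp,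
      by simp⟩
  | (v, a) :: l, hl => by
    obtain ⟨ha, hv, hl⟩ := hl
    obtain ⟨X, hX, f, b, x, hf, hp, hfix, -⟩ := exists_path G hl
    have hvx := hfix v hv
    have e : ∀ h c, extend G f v v h (x, c) = (x, h * c) := fun h c => by
      simp [extend_apply, extendFun, hvx]
    refine ⟨X × Δ, fun _ => have := hX ‹_›; inferInstance, extend G f v, (b, 1), (x, a),
      commute_extend G hf v, ?_, fun u hu h => ?_, fun _ hxb => ha (congrArg Prod.snd hxb)⟩
    · have e' := e a 1
      rw [mul_one] at e'
      rw [← e']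
      refine .cons v a (hp.extend G v) ?_
      rw [e']
      simpa using ha
    · simp only [IsHead, not_or, not_and] at hu
      by_cases hvu : G.Adj v u
      · simp [extend_apply, extendFun, hu.1, hvu, hfix u (hu.2 hvu) h]
      · simp [extend_apply, extendFun, hu.1, hvu, show a ≠ 1 from ha]

/-- A nonempty reduced word acts nontrivially in some permutation representation. -/
theorem exists_perm_prod_ne_one.{u} {Δ : Type u} [Group Δ] {l : List (V × Δ)} (hl : Reduced G l) (hne : l ≠ []) :
    ∃ (X : Type u) (_ : Finite Δ → Finite X) (f : V → Δ →* Equiv.Perm X),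
      (∀ v w, G.Adj v w → ∀ g h, Commute (f v g) (f w h)) ∧
      (l.map fun p => f p.1 p.2).prod ≠ 1 := by
  obtain ⟨X, hX, f, b, x, hf, hp, -, hxb⟩ := exists_path G hl
  refine ⟨X, hX, f, hf, fun h => hxb hne ?_⟩
  rw [← hp.prod_apply, h, Equiv.Perm.one_apply]

theorem lift_wordProd {M : Type*} [Group M] (f : V → Δ →* M)
    (hf : ∀ v w : V, G.Adj v w → ∀ g h : Δ, Commute (f v g) (f w h)) (l : List (V × Δ)) :
    lift f hf (wordProd G l) = (l.map fun p => f p.1 p.2).prod := by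
  simp [wordProd, map_list_prod, Function.comp_def]

theorem wordProd_ne_one {l : List (V × Δ)} (hl : Reduced G l) (hne : l ≠ []) :
    wordProd G l ≠ 1 := by
  obtain ⟨X, -, f, hf, h⟩ := exists_perm_prod_ne_one G hl hne
  intro h1
  rw [← lift_wordProd G f hf, h1, _root_.map_one] at h
  exact h rfl

theorem of_injective (v : V) : Function.Injective (of G v : Δ →* GraphProduct G Δ) := by
  rw [injective_iff_map_eq_one]
  intro a ha
  by_contra h
  exact wordProd_ne_one G (l := [(v, a)]) ⟨h, id, trivial⟩ (by simp) (by simp [ha])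

/-- The commutator is itself spelled by a reduced word of length four. -/
theorem not_commute_of {v w : V} (hne : v ≠ w) (hvw : ¬ G.Adj v w) {a b : Δ} (ha : a ≠ 1)
    (hb : b ≠ 1) : ¬ Commute (of G v a) (of G w b) := by
  intro h
  refine wordProd_ne_one G (l := [(v, a), (w, b), (v, a⁻¹), (w, b⁻¹)]) ?_ (by simp) ?_
  · have hwv : ¬ G.Adj w v := fun h => hvw h.symm
    simp [Reduced, IsHead, ha, hb, hne, hne.symm, hvw, hwv]
  · simp only [wordProd_cons, wordProd_nil, mul_one, map_inv]
    rw [← mul_assoc, h.eq]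
    group

end Action

/-! ### Reduced words in quotient graphs -/

section Quotient

/-- Any shuffle that is possible in the image already lifts to `G`. -/
theorem Reduced.map {V V' : Type*} {G : SimpleGraph V} {G' : SimpleGraph V'} {Δ Δ' : Type*}
    [Group Δ] [Group Δ'] {π : V → V'} {ψ : Δ →* Δ'} {S : Set V}
    (hinj : Set.InjOn π S) (hadj : ∀ v ∈ S, ∀ w ∈ S, G'.Adj (π v) (π w) → G.Adj v w) :
    ∀ {l : List (V × Δ)}, (∀ p ∈ l, p.1 ∈ S ∧ ψ p.2 ≠ 1) → Reduced G l →
      Reduced G' (l.map (Prod.map π ψ))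
  | [], _, _ => trivial
  | p :: l, hS, hl => by
    have hS' : ∀ q ∈ l, q.1 ∈ S ∧ ψ q.2 ≠ 1 := fun q hq => hS q (by simp [hq])
    have key : ∀ m : List (V × Δ), (∀ q ∈ m, q.1 ∈ S) → ∀ u ∈ S,
        IsHead G' (π u) (m.map (Prod.map π ψ)) → IsHead G u m := by
      intro m
      induction m with
      | nil => exact fun _ _ _ h => h
      | cons q m ih =>
        rintro hm u hu (h | ⟨h, h'⟩)
        · exact .inl (hinj hu (hm q (by simp)) h)
        · exact .inr ⟨hadj _ (hm q (by simp)) _ hu h, ih (fun r hr => hm r (by simp [hr])) u hu h'⟩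
    exact ⟨(hS p (by simp)).2, fun h => hl.2.1 (key l (fun q hq => (hS' q hq).1) p.1
      (hS p (by simp)).1 h), Reduced.map hinj hadj hS' hl.2.2⟩

/-- The quotient of a graph by an equivalence of its vertices, with loops removed. -/
def imageGraph {V V' : Type*} (G : SimpleGraph V) (π : V → V') : SimpleGraph V' where
  Adj q r := q ≠ r ∧ ∃ v w, π v = q ∧ π w = r ∧ G.Adj v w
  symm := ⟨fun _ _ ⟨h, v, w, hv, hw, hvw⟩ => ⟨h.symm, w, v, hw, hv, hvw.symm⟩⟩
  loopless := ⟨fun _ h => h.1 rfl⟩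

end Quotient

end GraphProduct

/-! ### General facts on finite-index subgroups -/

theorem Subgroup.exists_normal_finiteIndex_forall {Γ ι : Type*} [Group Γ]
    (P : ι → Subgroup Γ → Prop) (hP : ∀ i H K, H ≤ K → P i K → P i H) (s : Finset ι)
    (h : ∀ i ∈ s, ∃ K : Subgroup Γ, K.FiniteIndex ∧ P i K) :
    ∃ K : Subgroup Γ, K.Normal ∧ K.FiniteIndex ∧ ∀ i ∈ s, P i K := by
  have h' : ∀ i, ∃ K : Subgroup Γ, K.FiniteIndex ∧ (i ∈ s → P i K) := fun i => by
    by_cases hi : i ∈ s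
    · obtain ⟨K, hK, hPK⟩ := h i hi
      exact ⟨K, hK, fun _ => hPK⟩
    · exact ⟨⊤, inferInstance, fun hi' => absurd hi' hi⟩
  choose f hf hPf using h'
  have : (⨅ i ∈ s, f i).FiniteIndex := Subgroup.finiteIndex_iInf' f fun i _ => hf i
  exact ⟨(⨅ i ∈ s, f i).normalCore, inferInstance, inferInstance, fun i hi =>
    hP i _ _ ((Subgroup.normalCore_le _).trans (iInf₂_le i hi)) (hPf i hi)⟩

theorem Group.ResiduallyFinite.of_injective {A B : Type*} [Group A] [Group B]
    [hB : Group.ResiduallyFinite B] (f : A →* B) (hf : Function.Injective f) :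
    Group.ResiduallyFinite A := by
  rw [Group.residuallyFinite_iff_exists_finiteIndexNormalSubgroup] at hB ⊢
  intro a ha
  obtain ⟨H, hfa⟩ := hB (f a) (by rwa [ne_eq, map_eq_one_iff f hf])
  exact ⟨H.comap f, hfa⟩

/-! ### Finite quotients of the wreath product -/

section Wreath

variable {Γ Δ : Type*} [Group Γ] [Group Δ] {G : SimpleGraph Γ}

theorem GraphWreathProduct.inr_mul_inl_of {V : Type*} {G : SimpleGraph V} (ρ : Γ →* (G ≃g G))
    (k : Γ) (v : V) (a : Δ) :
    (SemidirectProduct.inl (GraphProduct.of G (ρ k v) a) : GraphWreathProduct ρ Δ) =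
      SemidirectProduct.inr k * SemidirectProduct.inl (GraphProduct.of G v a) *
        SemidirectProduct.inr k⁻¹ := by
  rw [← SemidirectProduct.inl_aut]
  exact congrArg _ (GraphProduct.map_of (ρ k) v a).symm

theorem GraphWreathProduct.exists_finiteIndex_not_commute {V : Type*} {G : SimpleGraph V}
    (ρ : Γ →* (G ≃g G)) [hW : Group.ResiduallyFinite (GraphWreathProduct ρ Δ)] {v w : V} {a b : Δ}
    (h : ¬ Commute (GraphProduct.of G v a) (GraphProduct.of G w b)) :
    ∃ K : Subgroup Γ, K.FiniteIndex ∧ ∀ k ∈ K,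
      ¬ Commute (GraphProduct.of G (ρ k v) a) (GraphProduct.of G w b) := by
  rw [← commutatorElement_eq_one_iff_commute] at h
  obtain ⟨N, hN⟩ := Group.residuallyFinite_iff_exists_finiteIndexNormalSubgroup.1 hW
    (SemidirectProduct.inl ⁅GraphProduct.of G v a, GraphProduct.of G w b⁆)
    fun h1 => h (SemidirectProduct.inl_injective (h1.trans (_root_.map_one _).symm))
  let M := N.comap (SemidirectProduct.inr : Γ →* GraphWreathProduct ρ Δ)
  refine ⟨M.toSubgroup, M.isFiniteIndex', fun k hk hc => hN ?_⟩
  let q := QuotientGroup.mk' N.toSubgroup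
  have hq : ∀ x, q x = 1 ↔ x ∈ N := fun x => QuotientGroup.eq_one_iff x
  have hk1 : q (SemidirectProduct.inr k) = 1 := (hq _).2 hk
  have e : q (SemidirectProduct.inl (GraphProduct.of G (ρ k v) a)) =
      q (SemidirectProduct.inl (GraphProduct.of G v a)) := by
    rw [inr_mul_inl_of, map_mul, map_mul, map_inv, map_inv, hk1]
    simp
  rw [← hq, map_commutatorElement, map_commutatorElement, ← e, ← map_commutatorElement,
    ← map_commutatorElement, hc.commutator_eq, map_one, map_one]

/-- A finite permutation representation of the graph product that is invariant under a
finite-index subgroup of the acting group gives a finite-index subgroup of the wreath product. -/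
theorem GraphWreathProduct.exists_finiteIndex_inl_notMem {V : Type*} {G : SimpleGraph V}
    (ρ : Γ →* (G ≃g G)) {P : Type*} [Group P] [Finite P] (φ : GraphProduct G Δ →* P)
    (K : Subgroup Γ) [hK : K.FiniteIndex]
    (hφ : ∀ k ∈ K, ∀ x, φ (GraphProduct.map Δ (ρ k) x) = φ x)
    {x : GraphProduct G Δ} (hx : φ x ≠ 1) :
    ∃ H : Subgroup (GraphWreathProduct ρ Δ), H.FiniteIndex ∧ SemidirectProduct.inl x ∉ H := by
  let L : Subgroup (GraphWreathProduct ρ Δ) := K.comap SemidirectProduct.rightHom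
  -- Over `K` the twist of the semidirect product is invisible to `φ`, so forgetting the `Γ`-part is
  -- multiplicative.
  let ψ : L →* P :=
    { toFun := fun y => φ y.1.left
      map_one' := map_one φ
      map_mul' := fun y z => by
        have : φ (GraphProduct.map Δ (ρ y.1.right) z.1.left) = φ z.1.left := hφ _ y.2 _
        rw [← this, ← map_mul]
        rfl }
  have hL : L.index ≠ 0 := by
    rw [Subgroup.index_comap_of_surjective _ SemidirectProduct.rightHom_surjective]
    exact hK.index_ne_zero
  refine ⟨ψ.ker.map L.subtype, ⟨?_⟩, ?_⟩
  · rw [Subgroup.index_map_subtype]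
    exact mul_ne_zero (Subgroup.finiteIndex_ker ψ).index_ne_zero hL
  · rintro ⟨y, hy, hyx⟩
    refine hx ?_
    have : φ y.1.left = 1 := hy
    rw [show y.1 = SemidirectProduct.inl x from hyx] at this
    exact this

theorem GraphProduct.exists_invariant_finite_hom.{u} {Δ : Type u} [Group Δ]
    (hG : ∀ γ v w : Γ, G.Adj v w → G.Adj (γ * v) (γ * w))
    [hΓ : Group.ResiduallyFinite Γ] [hΔ : Group.ResiduallyFinite Δ]
    (h1 : (∀ a b : Δ, a * b = b * a) ∨
      ∃ K : Subgroup Γ, K.FiniteIndex ∧ ∀ k ∈ K, ¬ G.Adj 1 k)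
    (h2 : ∀ w : Γ, ¬ G.Adj 1 w → w ≠ 1 →
      ∃ K : Subgroup Γ, K.FiniteIndex ∧ ∀ k ∈ K, ¬ G.Adj 1 (k * w))
    {x : GraphProduct G Δ} (hx : x ≠ 1) :
    ∃ (K : Subgroup Γ) (_ : K.FiniteIndex) (P : Type u) (_ : Group P) (_ : Finite P)
      (φ : GraphProduct G Δ →* P), φ x ≠ 1 ∧
      ∀ k ∈ K, ∀ y, φ (GraphProduct.map Δ (leftMulGraphAction G hG k) y) = φ y := by
  classical
  obtain ⟨l, hl, rfl⟩ := exists_reduced_wordProd_eq G x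
  have hne : l ≠ [] := by
    rintro rfl
    exact hx rfl
  have hl1 : ∀ p ∈ l, p.2 ≠ 1 := by
    clear hx hne
    induction l with
    | nil => simp
    | cons p l ih => exact List.forall_mem_cons.2 ⟨hl.1, ih hl.2.2⟩
  obtain ⟨N, hN, hNf, hNl⟩ := Subgroup.exists_normal_finiteIndex_forall
    (fun (p : Γ × Δ) (K : Subgroup Δ) => p.2 ∉ K) (fun _ _ _ hHK h h' => h (hHK h')) l.toFinset
    fun p hp => Group.residuallyFinite_iff_exists_finiteIndex.1 hΔ p.2 (hl1 p (by simpa using hp))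
  let S : Finset Γ := (l.map Prod.fst).toFinset
  -- Modulo `K`, distinct vertices of the word stay distinct and non-adjacent ones stay
  -- non-adjacent. The last clause does not depend on the pair.
  obtain ⟨K, hK, hKf, hKS⟩ := Subgroup.exists_normal_finiteIndex_forall
    (fun (p : Γ × Γ) (K : Subgroup Γ) => (p.1 ≠ p.2 → p.1⁻¹ * p.2 ∉ K ∧
      (¬ G.Adj p.1 p.2 → ∀ k ∈ K, ¬ G.Adj 1 (k * (p.1⁻¹ * p.2)))) ∧
      ((∀ a b : Δ, a * b = b * a) ∨ ∀ k ∈ K, ¬ G.Adj 1 k))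
    (fun p H K hHK h => ⟨fun hp => ⟨fun h' => (h.1 hp).1 (hHK h'),
      fun ha k hk => (h.1 hp).2 ha k (hHK hk)⟩, h.2.imp id fun h k hk => h k (hHK hk)⟩)
    (S ×ˢ S) (by
      rintro ⟨v, w⟩ -
      obtain ⟨A, hA, hA'⟩ : ∃ A : Subgroup Γ, A.FiniteIndex ∧
          ((∀ a b : Δ, a * b = b * a) ∨ ∀ k ∈ A, ¬ G.Adj 1 k) := by
        rcases h1 with h | ⟨A, hA, h⟩
        · exact ⟨⊤, inferInstance, .inl h⟩
        · exact ⟨A, hA, .inr h⟩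
      by_cases hvw : v = w
      · exact ⟨A, hA, fun h => absurd hvw h, hA'⟩
      have hvw' : v⁻¹ * w ≠ 1 := by simpa [inv_mul_eq_one] using hvw
      obtain ⟨B, hB, hB'⟩ := Group.residuallyFinite_iff_exists_finiteIndex.1 hΓ _ hvw'
      obtain ⟨C, hC, hC'⟩ : ∃ C : Subgroup Γ, C.FiniteIndex ∧
          (¬ G.Adj v w → ∀ k ∈ C, ¬ G.Adj 1 (k * (v⁻¹ * w))) := by
        by_cases ha : G.Adj v w
        · exact ⟨⊤, inferInstance, fun h => absurd ha h⟩
        · obtain ⟨C, hC, h⟩ := h2 (v⁻¹ * w)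
            (fun h => ha (by simpa using hG v _ _ h)) hvw'
          exact ⟨C, hC, fun _ => h⟩
      exact ⟨A ⊓ (B ⊓ C), inferInstance, fun _ => ⟨fun h => hB' h.2.1,
        fun ha k hk => hC' ha k hk.2.2⟩, hA'.imp id fun h k hk => h k hk.1⟩)
  have hS : ∀ p ∈ l, p.1 ∈ S := fun p hp => by
    simpa [S] using ⟨p.2, hp⟩
  have hloop : (∀ a b : Δ, a * b = b * a) ∨ ∀ k ∈ K, ¬ G.Adj 1 k := by
    obtain ⟨p, hp⟩ := List.exists_mem_of_ne_nil l hne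
    exact (hKS (p.1, p.1) (Finset.mk_mem_product (hS p hp) (hS p hp))).2
  let π : Γ → Γ ⧸ K := fun v => v
  let ψ : Δ →* Δ ⧸ N := QuotientGroup.mk' N
  have hred : Reduced (imageGraph G π) (l.map (Prod.map π ψ)) := by
    refine Reduced.map (S := S) (fun v hv w hw hvw => ?_) (fun v hv w hw h => ?_)
      (fun p hp => ⟨hS p hp, fun h => hNl p (by simpa using hp)
        ((QuotientGroup.eq_one_iff _).1 h)⟩) hl
    · by_contra hne
      exact ((hKS (v, w) (Finset.mk_mem_product hv hw)).1 hne).1 (QuotientGroup.eq.1 hvw)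
    · obtain ⟨hne, v', w', hv', hw', ha⟩ := h
      by_contra hvw
      -- If representatives `v'`, `w'` are adjacent, then so are `1` and `v'⁻¹ * w'`, which
      -- normality of `K` writes as `k * (v⁻¹ * w)` with `k ∈ K`.
      refine ((hKS (v, w) (Finset.mk_mem_product hv hw)).1 (fun h => hne (congrArg π h))).2 hvw
        ((v'⁻¹ * v) * ((v⁻¹ * w) * (w⁻¹ * w') * (v⁻¹ * w)⁻¹))
        (K.mul_mem (QuotientGroup.eq.1 hv')
          (hK.conj_mem _ (QuotientGroup.eq.1 hw'.symm) _)) ?_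
      have := hG v'⁻¹ _ _ ha
      rw [inv_mul_cancel] at this
      convert this using 1
      group
  obtain ⟨X, hX, f, hf, hprod⟩ := exists_perm_prod_ne_one (imageGraph G π) hred (by simpa using hne)
  have : Finite X := hX inferInstance
  refine ⟨K, hKf, Equiv.Perm X, inferInstance, inferInstance,
    lift (fun v => (f (π v)).comp ψ) fun v w hvw g h => ?_, ?_, fun k hk y => ?_⟩
  -- An edge inside one coset is a loop, absent from `imageGraph`: either `Δ` is abelian and the
  -- images commute, or condition 1 excludes such an edge.
  · by_cases hπ : π v = π w
    · rcases hloop with hab | hl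
      · have : Commute g h := hab g h
        rw [hπ]
        exact this.map ((f (π w)).comp ψ)
      · refine absurd ?_ (hl (v⁻¹ * w) (QuotientGroup.eq.1 hπ))
        simpa using hG v⁻¹ _ _ hvw
    · exact hf _ _ ⟨hπ, v, w, rfl, rfl, hvw⟩ _ _
  · rw [lift_wordProd]
    simpa [Function.comp_def] using hprod
  · rw [← MonoidHom.comp_apply]
    refine DFunLike.congr_fun (hom_ext fun v g => ?_) y
    rw [MonoidHom.comp_apply, map_of, lift_of, lift_of]
    have : π (k * v) = π v := by
      refine (QuotientGroup.eq.2 ?_).symm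
      simpa [mul_assoc] using hK.conj_mem k hk v⁻¹
    change f (π (k * v)) (ψ g) = f (π v) (ψ g)
    rw [this]

end Wreath

/-! ### The equivalence -/

theorem corollary3p4p1 {Γ Δ : Type*} [Group Γ] [Group Δ] [Nontrivial Δ] (G : SimpleGraph Γ)
    (hG : ∀ γ v w : Γ, G.Adj v w → G.Adj (γ * v) (γ * w)) :
    Group.ResiduallyFinite (GraphWreathProduct (leftMulGraphAction G hG) Δ) ↔
      (Group.ResiduallyFinite Γ ∧ Group.ResiduallyFinite Δ) ∧
      ((∀ a b : Δ, a * b = b * a) ∨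
        ∃ K : Subgroup Γ, K.FiniteIndex ∧ (K : Set Γ) ∩ G.neighborSet 1 = ∅) ∧
      (∀ w : Γ, ¬ G.Adj 1 w → w ≠ 1 →
        ∃ K : Subgroup Γ, K.FiniteIndex ∧
          ((fun k : Γ => k * w) '' (K : Set Γ)) ∩ (G.neighborSet 1 ∪ {1}) = ∅) := by
  have hK1 : ∀ K : Subgroup Γ, (K : Set Γ) ∩ G.neighborSet 1 = ∅ ↔ ∀ k ∈ K, ¬ G.Adj 1 k := by
    intro K
    simp [Set.eq_empty_iff_forall_notMem]
  have hK2 : ∀ (K : Subgroup Γ) (w : Γ),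
      ((fun k : Γ => k * w) '' (K : Set Γ)) ∩ (G.neighborSet 1 ∪ {1}) = ∅ ↔
        ∀ k ∈ K, ¬ (k * w = 1 ∨ G.Adj 1 (k * w)) := by
    intro K w
    simp [Set.eq_empty_iff_forall_notMem, -Set.image_mul_right]
  simp only [hK1, hK2]
  constructor
  · intro hW
    refine ⟨⟨.of_injective (SemidirectProduct.inr : Γ →* GraphWreathProduct
      (leftMulGraphAction G hG) Δ) SemidirectProduct.inr_injective, .of_injective
      ((SemidirectProduct.inl : _ →* GraphWreathProduct (leftMulGraphAction G hG) Δ).comp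
        (GraphProduct.of G 1))
      (SemidirectProduct.inl_injective.comp (GraphProduct.of_injective G 1))⟩, ?_, ?_⟩
    · by_contra! h
      obtain ⟨⟨a, b, hab⟩, h⟩ := h
      -- Non-commuting `a`, `b` in the same copy of `Δ`: an element `k ∈ K` adjacent to `1` would
      -- make `a_(k)` and `b_(1)` commute.
      obtain ⟨K, hK, hc⟩ := GraphWreathProduct.exists_finiteIndex_not_commute
        (leftMulGraphAction G hG) (v := (1 : Γ)) (w := 1) (a := a) (b := b) (fun hc => hab
          (GraphProduct.of_injective G 1 (by rw [map_mul, map_mul]; exact hc)))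
      obtain ⟨k, hk, hadj⟩ := h K hK
      refine hc k hk (GraphProduct.commute_of ?_ a b)
      change G.Adj (k * 1) 1
      rw [mul_one]
      exact hadj.symm
    · intro w hw hw1
      obtain ⟨a, ha⟩ := exists_ne (1 : Δ)
      obtain ⟨K, hK, hc⟩ := GraphWreathProduct.exists_finiteIndex_not_commute
        (leftMulGraphAction G hG)
        (GraphProduct.not_commute_of G hw1 (fun h => hw h.symm) ha ha)
      refine ⟨K, hK, fun k hk => ?_⟩
      rintro (h | h)
      -- If `k * w = 1`, both factors are the same element `a_(1)`.
      · refine hc k hk ?_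
        change Commute (GraphProduct.of G (k * w) a) _
        rw [h]
      · exact hc k hk (GraphProduct.commute_of h.symm a a)
  · rintro ⟨⟨hΓ, hΔ⟩, h1, h2⟩
    rw [Group.residuallyFinite_iff_exists_finiteIndex]
    intro y hy
    by_cases hr : y.right = 1
    · have hyl : y = SemidirectProduct.inl y.left := SemidirectProduct.ext rfl hr
      have hx : y.left ≠ 1 := fun h => hy (by rw [hyl, h, map_one])
      obtain ⟨K, hK, P, _, _, φ, hφx, hφ⟩ := GraphProduct.exists_invariant_finite_hom hG h1
        -- The clause `k * w ≠ 1` can be dropped, since residual finiteness of `Γ` already separates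
        -- vertices.
        (fun w hw hw1 => (h2 w hw hw1).imp fun K h => ⟨h.1, fun k hk ha => h.2 k hk (.inr ha)⟩) hx
      rw [hyl]
      exact GraphWreathProduct.exists_finiteIndex_inl_notMem _ φ K hφ hφx
    · obtain ⟨N, hN⟩ := Group.residuallyFinite_iff_exists_finiteIndexNormalSubgroup.1 hΓ _ hr
      let M := N.comap (SemidirectProduct.rightHom :
        GraphWreathProduct (leftMulGraphAction G hG) Δ →* Γ)
      exact ⟨M.toSubgroup, M.isFiniteIndex', hN⟩
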